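/- Theorem 1.2. Let $X$ be a separable real Banach space, let $Y$ be a real Banach space with the Radon–Nikodym property, and let $f\colon X\to Y$ be a Lipschitz map. Call $f$ *Gateaux differentiable* at $x_0\in X$ if for every $x\in X$ the limit $\lim_{t\to 0}\frac{1}{t}\bigl(f(x_0+tx)-f(x_0)\bigr)$ exists in $Y$ and is a bounded linear function of $x$. Call a Borel set $A\subseteq X$ a *Christensen zero set* if there is a Borel probability measure $\mu$ on $X$ such that $\chi_A*\mu\equiv 0$, that is, $\int_X\chi_A(x-y)\,d\mu(y)=0$ for all $x\in X$. Then $f$ is Gateaux differentiable at at least one point of $X$; moreover, the set of all points of $X$ at which $f$ is not Gateaux differentiable is (a Borel set and) a Christensen zero set. Here $Y$ has the Radon–Nikodym property if, for every finite measure space $(\Omega,\Sigma,\mu)$ and every countably additive vector measure $\nu\colon\Sigma\to Y$ of bounded variation with $\nu(A)=0$ whenever $\mu(A)=0$, there is a Bochner $\mu$-integrable $g\colon\Omega\to Y$ with $\nu(A)=\int_A g\,d\mu$ for all $A\in\Sigma$. -/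

import Mathlib

open MeasureTheory
open scoped NNReal ENNReal

universe w u v

/-- A real Banach space `Y` has the Radon–Nikodym property if every countably additive `Y`-valued
vector measure `ν` of bounded variation that is absolutely continuous with respect to a finite
measure `μ` is the indefinite Bochner integral of some `μ`-integrable function.
(The universe `w` of the underlying measurable spaces is arbitrary.) -/
def HasRadonNikodymProperty (Y : Type v) [NormedAddCommGroup Y] [NormedSpace ℝ Y]
    [CompleteSpace Y] : Prop :=
  ∀ (Ω : Type w) [MeasurableSpace Ω] (μ : Measure Ω) [IsFiniteMeasure μ]
    (ν : VectorMeasure Ω Y),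
    ν.variation Set.univ < ∞ →
    (∀ s : Set Ω, MeasurableSet s → μ s = 0 → ν s = 0) →
    ∃ g : Ω → Y, Integrable g μ ∧ ∀ s : Set Ω, MeasurableSet s → ν s = ∫ ω in s, g ω ∂μ

/-- `f` is Gateaux differentiable at `x`: for every direction `v` the limit, as `t → 0`, of
`t⁻¹ • (f (x + t • v) - f x)` exists, and it is a bounded linear function of `v`. -/
def GateauxDifferentiableAt {X Y : Type*} [NormedAddCommGroup X] [NormedSpace ℝ X]
    [NormedAddCommGroup Y] [NormedSpace ℝ Y] (f : X → Y) (x : X) : Prop :=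
  ∃ T : X →L[ℝ] Y, ∀ v : X, HasLineDerivAt ℝ f (T v) x v

/-- A zero set in the sense of Christensen: a Borel set `A` for which there is a Borel probability
measure `μ` such that `∫ χ_A (x - y) dμ(y) = 0` for all `x`. -/
def IsChristensenZeroSet {X : Type*} [NormedAddCommGroup X] [MeasurableSpace X] [BorelSpace X]
    (A : Set X) : Prop :=
  MeasurableSet A ∧ ∃ μ : Measure X, IsProbabilityMeasure μ ∧
    ∀ x : X, ∫⁻ y, A.indicator (fun _ => (1 : ℝ≥0∞)) (x - y) ∂μ = 0

/-! Let `q` be dense in `X`. Slopes of a Lipschitz map are equi-Lipschitz in the direction, so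
Gateaux differentiability at a point reduces to countably many conditions, each involving only two
directions `q i`, `q j` (`LipschitzWith.gateauxDifferentiableAt_iff`). This also makes the
exceptional set Borel.

The Christensen measure is the law of `∑ ωₖ cₖ qₖ` with independent uniform `ωₖ` in `[0, 1]` and
weights making the series converge. Freezing all coordinates but `i` and `j`, the random point moves
in a plane spanned by `q i` and `q j`, so each condition follows from its almost everywhere validity
in the plane.

That is a weak Rademacher theorem: the Radon–Nikodym property differentiates Lipschitz curves,
Fubini yields line derivatives, and integration by parts against test functions yields their
additivity. -/

open Set Filter Topology

/-! ### Lipschitz curves in spaces with the Radon–Nikodym property. -/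

section RadonNikodym

variable {Y : Type v} [NormedAddCommGroup Y] [NormedSpace ℝ Y] [CompleteSpace Y]

/-- The Radon–Nikodym property in any universe implies it in the lowest one. -/
theorem HasRadonNikodymProperty.lower (hY : HasRadonNikodymProperty.{w, v} Y) :
    HasRadonNikodymProperty.{0, v} Y := by
  intro Ω _ μ _ ν hν hac
  have hup : Measurable (ULift.up.{w, 0} : Ω → ULift.{w, 0} Ω) := measurable_up
  have hdown : Measurable (ULift.down.{w, 0} : ULift.{w, 0} Ω → Ω) := measurable_down
  obtain ⟨g, hg, hgν⟩ := hY (ULift.{w, 0} Ω) (μ.map ULift.up) (ν.map ULift.up)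
    (by
      refine (VectorMeasure.variation_map_le univ).trans_lt ?_
      rwa [Measure.map_apply hup .univ, preimage_univ])
    (fun s hs h ↦ by
      rw [Measure.map_apply hup hs] at h
      rw [VectorMeasure.map_apply _ hup hs]
      exact hac _ (hup hs) h)
  refine ⟨g ∘ ULift.up, hg.comp_measurable hup, fun s hs ↦ ?_⟩
  have h := hgν (ULift.down ⁻¹' s) (hdown hs)
  have hemb : MeasurableEmbedding (ULift.up.{w, 0} : Ω → ULift.{w, 0} Ω) :=
    MeasurableEquiv.ulift.symm.measurableEmbedding
  rw [VectorMeasure.map_apply _ hup (hdown hs), hemb.setIntegral_map] at h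
  exact h

/-- A Lipschitz function on a compact interval is the primitive of an integrable function, when
the target has the Radon–Nikodym property. -/
theorem HasRadonNikodymProperty.exists_primitive (hY : HasRadonNikodymProperty.{w, v} Y)
    {f : ℝ → Y} {K : ℝ≥0} (hf : LipschitzWith K f) {a b : ℝ} (hab : a ≤ b) :
    ∃ g : ℝ → Y, IntervalIntegrable g volume a b ∧
      ∀ x ∈ Icc a b, f x - f a = ∫ t in a..x, g t := by
  -- Clamping makes the increments of `F` vanish off `[a, b]`, so the finite measure `μ` dominates
  -- them on every half-open interval and they extend to a vector measure.
  let F : ℝ → Y := fun x ↦ f (projIcc a b hab x)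
  let μ : Measure ℝ := K • volume.restrict (Icc a b)
  let m := AddContent.onIoc F
  have hm : ∀ s ∈ {s | ∃ u v, u ≤ v ∧ s = Ioc u v}, ‖m s‖ₑ ≤ μ s := by
    rintro s ⟨u, v, huv, rfl⟩
    rw [AddContent.onIoc_apply huv, ← edist_eq_enorm_sub]
    refine (hf _ _).trans ?_
    have hle : (projIcc a b hab u : ℝ) ≤ projIcc a b hab v := monotone_projIcc hab huv
    have hsub : Ioo (projIcc a b hab u : ℝ) (projIcc a b hab v) ⊆ Ioc u v ∩ Icc a b := by
      intro x hx
      have h1 := (projIcc a b hab u).2.1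
      have h2 := (projIcc a b hab v).2.2
      have hx' : a ≤ x ∧ x ≤ b := ⟨h1.trans hx.1.le, hx.2.le.trans h2⟩
      refine ⟨⟨?_, ?_⟩, hx'⟩
      · by_contra! h
        have := monotone_projIcc hab h
        rw [projIcc_of_mem hab hx'] at this
        exact absurd hx.1 (not_lt.2 this)
      · by_contra! h
        have := monotone_projIcc hab h.le
        rw [projIcc_of_mem hab hx'] at this
        exact absurd hx.2 (not_lt.2 this)
    simp only [μ, Measure.smul_apply, Measure.restrict_apply measurableSet_Ioc]
    rw [ENNReal.smul_def, smul_eq_mul]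
    gcongr
    refine le_trans ?_ (measure_mono hsub)
    rw [edist_dist, Real.dist_eq, abs_of_nonneg (sub_nonneg.2 hle), Real.volume_Ioo]
  have hgen : (inferInstance : MeasurableSpace ℝ) =
      MeasurableSpace.generateFrom {s | ∃ u v, u ≤ v ∧ s = Ioc u v} := by
    rw [BorelSpace.measurable_eq (α := ℝ)]
    convert! borel_eq_generateFrom_Ioc_le ℝ using 2
    grind only
  obtain ⟨ν, hνm, hνμ⟩ :=
    VectorMeasure.exists_extension_of_isSetSemiring_of_le_measure_of_generateFrom
      IsSetSemiring.Ioc hm hgen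
  obtain ⟨g, hg, hgν⟩ := hY.lower ℝ (volume.restrict (Icc a b)) ν
    ((VectorMeasure.variation_le_of_forall_enorm_le fun s _ ↦ hνμ s) univ |>.trans_lt
      (measure_lt_top μ univ))
    (fun s _ h ↦ by
      have := hνμ s
      simpa [μ, h] using this)
  refine ⟨g, (intervalIntegrable_iff_integrableOn_Icc_of_le hab).2 hg, fun x hx ↦ ?_⟩
  have h := hgν (Ioc a x) measurableSet_Ioc
  rw [hνm _ ⟨a, x, hx.1, rfl⟩, AddContent.onIoc_apply hx.1, Measure.restrict_restrict
    measurableSet_Ioc, inter_eq_left.2 (Ioc_subset_Icc_self.trans (Icc_subset_Icc_right hx.2)),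
    ← intervalIntegral.integral_of_le hx.1] at h
  rw [← h]
  simp [F, projIcc_of_mem hab hx]

/-- A Lipschitz function from `ℝ` to a space with the Radon–Nikodym property is differentiable
almost everywhere. -/
theorem HasRadonNikodymProperty.ae_differentiableAt (hY : HasRadonNikodymProperty.{w, v} Y)
    {f : ℝ → Y} {K : ℝ≥0} (hf : LipschitzWith K f) : ∀ᵐ x, DifferentiableAt ℝ f x := by
  have key (n : ℕ) : ∀ᵐ x : ℝ, x ∈ Ioo (-n : ℝ) n → DifferentiableAt ℝ f x := by
    have hn : (-n : ℝ) ≤ n := by linarith [n.cast_nonneg (α := ℝ)]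
    obtain ⟨g, hg, hgf⟩ := hY.exists_primitive hf hn
    filter_upwards [hg.ae_hasDerivAt_integral] with x hx hxn
    rw [uIcc_of_le hn] at hx
    have hd := (hx (Ioo_subset_Icc_self hxn) (-n) (left_mem_Icc.2 hn)).add_const (f (-n))
    refine (hd.congr_of_eventuallyEq ?_).differentiableAt
    filter_upwards [Ioo_mem_nhds hxn.1 hxn.2] with y hy
    rw [← hgf y (Ioo_subset_Icc_self hy), sub_add_cancel]
  filter_upwards [ae_all_iff.2 key] with x hx
  obtain ⟨n, hn⟩ := exists_nat_gt |x|
  exact hx n (abs_lt.1 hn)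

end RadonNikodym

/-! ### Rademacher-type results in finite dimension. -/

section FiniteDimensional

variable {E : Type*} [NormedAddCommGroup E] [NormedSpace ℝ E] [MeasurableSpace E] [BorelSpace E]
  [FiniteDimensional ℝ E] {μ : Measure E} [μ.IsAddHaarMeasure]
  {Y : Type v} [NormedAddCommGroup Y] [NormedSpace ℝ Y]
  {f : E → Y} {K D : ℝ≥0} {g : E → ℝ}

theorem tendsto_integral_slope_smul
    (hg : LipschitzWith D g) (h'g : HasCompactSupport g) (hf : Continuous f) (v : E) :
    Tendsto (fun t : ℝ ↦ ∫ x, (t⁻¹ • (g (x + t • v) - g x)) • f x ∂μ) (𝓝[>] 0)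
      (𝓝 (∫ x, lineDeriv ℝ g x v • f x ∂μ)) := by
  have hgc := hg.continuous
  -- For `0 < t ≤ 1`, both `g x` and `g (x + t • v)` vanish when `x` is outside `S`.
  let S := Metric.cthickening ‖v‖ (tsupport g)
  have hS : IsCompact S := IsCompact.cthickening h'g
  apply tendsto_integral_filter_of_dominated_convergence
      (S.indicator (fun x ↦ (D * ‖v‖) * ‖f x‖))
  · filter_upwards with t
    exact Continuous.aestronglyMeasurable (by fun_prop)
  · filter_upwards [Ioc_mem_nhdsGT zero_lt_one] with t ht
    have t_pos : 0 < t := ht.1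
    filter_upwards with x
    by_cases hx : x ∈ S
    · calc ‖(t⁻¹ • (g (x + t • v) - g x)) • f x‖
        = (t⁻¹ * ‖g (x + t • v) - g x‖) * ‖f x‖ := by
              rw [norm_smul, norm_smul, norm_inv, Real.norm_of_nonneg t_pos.le]
      _ ≤ (t⁻¹ * (D * ‖(x + t • v) - x‖)) * ‖f x‖ := by
        gcongr; exact hg.norm_sub_le (x + t • v) x
      _ = (D * ‖v‖) * ‖f x‖ := by simp [field, norm_smul, abs_of_nonneg t_pos.le]
      _ = S.indicator (fun x ↦ (D * ‖v‖) * ‖f x‖) x := by rw [indicator_of_mem hx]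
    · have A : g x = 0 := by
        rw [← Function.notMem_support]
        contrapose hx
        exact Metric.self_subset_cthickening _ (subset_tsupport _ hx)
      have B : g (x + t • v) = 0 := by
        rw [← Function.notMem_support]
        contrapose hx
        apply Metric.mem_cthickening_of_dist_le _ _ (‖v‖) (tsupport g) (subset_tsupport _ hx)
        simp only [dist_eq_norm, sub_add_cancel_left, norm_neg, norm_smul, Real.norm_eq_abs,
          abs_of_nonneg t_pos.le]
        exact mul_le_of_le_one_left (norm_nonneg v) ht.2
      simp only [B, A, sub_self, smul_zero, zero_smul, norm_zero]
      exact indicator_nonneg (fun y _ ↦ by positivity) _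
  · rw [integrable_indicator_iff hS.measurableSet]
    exact ContinuousOn.integrableOn_compact hS (by fun_prop)
  · filter_upwards [hg.ae_lineDifferentiableAt v] with x hx
    exact hx.hasLineDerivAt.tendsto_slope_zero_right.smul tendsto_const_nhds

variable [CompleteSpace Y]

namespace HasRadonNikodymProperty

theorem ae_lineDifferentiableAt (hY : HasRadonNikodymProperty.{w, v} Y)
    (hf : LipschitzWith K f) (v : E) : ∀ᵐ p ∂μ, LineDifferentiableAt ℝ f p v := by
  let L : ℝ →L[ℝ] E := ContinuousLinearMap.smulRight (1 : ℝ →L[ℝ] ℝ) v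
  suffices A : ∀ p, ∀ᵐ (t : ℝ) ∂volume, LineDifferentiableAt ℝ f (p + t • v) v from
    ae_mem_of_ae_add_linearMap_mem L.toLinearMap volume μ
      (measurableSet_lineDifferentiableAt hf.continuous) A
  intro p
  filter_upwards [hY.ae_differentiableAt (hf.comp ((LipschitzWith.const p).add L.lipschitz))]
    with s hs
  have h's : DifferentiableAt ℝ (fun t ↦ f (p + t • v)) (s + 0) := by
    rw [add_zero]; exact hs
  have : DifferentiableAt ℝ (fun t ↦ s + t) 0 := differentiableAt_id.const_add _
  simp only [LineDifferentiableAt]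
  convert! h's.comp 0 this with _ t
  simp only [add_assoc, Function.comp_apply, add_smul]

theorem tendsto_integral_smul_slope (hY : HasRadonNikodymProperty.{w, v} Y)
    (hf : LipschitzWith K f) (hg : Integrable g μ) (v : E) :
    Tendsto (fun t : ℝ ↦ ∫ x, g x • (t⁻¹ • (f (x + t • v) - f x)) ∂μ) (𝓝[>] 0)
      (𝓝 (∫ x, g x • lineDeriv ℝ f x v ∂μ)) := by
  have hfc := hf.continuous
  apply tendsto_integral_filter_of_dominated_convergence (fun x ↦ (K * ‖v‖) * ‖g x‖)
  · filter_upwards with t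
    refine hg.aestronglyMeasurable.smul ?_
    exact Continuous.aestronglyMeasurable (by fun_prop)
  · filter_upwards [self_mem_nhdsWithin] with t (ht : 0 < t)
    filter_upwards with x
    calc ‖g x • (t⁻¹ • (f (x + t • v) - f x))‖
      = (t⁻¹ * ‖f (x + t • v) - f x‖) * ‖g x‖ := by
            rw [norm_smul, norm_smul, norm_inv, Real.norm_of_nonneg ht.le, mul_comm]
    _ ≤ (t⁻¹ * (K * ‖(x + t • v) - x‖)) * ‖g x‖ := by
      gcongr; exact hf.norm_sub_le (x + t • v) x
    _ = (K * ‖v‖) * ‖g x‖ := by simp [field, norm_smul, abs_of_nonneg ht.le]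
  · exact hg.norm.const_mul _
  · filter_upwards [hY.ae_lineDifferentiableAt hf v] with x hx
    exact tendsto_const_nhds.smul hx.hasLineDerivAt.tendsto_slope_zero_right

/-- Integration by parts for line derivatives of Lipschitz functions. -/
theorem integral_smul_lineDeriv_eq (hY : HasRadonNikodymProperty.{w, v} Y)
    (hf : LipschitzWith K f) (hg : LipschitzWith D g) (h'g : HasCompactSupport g) (v : E) :
    ∫ x, g x • lineDeriv ℝ f x v ∂μ = ∫ x, lineDeriv ℝ g x (-v) • f x ∂μ := by
  have hfc := hf.continuous
  have hgc := hg.continuous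
  have A := hY.tendsto_integral_smul_slope (μ := μ) hf (hgc.integrable_of_hasCompactSupport h'g) v
  have B := tendsto_integral_slope_smul (μ := μ) hg h'g hfc (-v)
  -- Translation invariance of `μ` moves the difference quotient from `f` to `g` before the limit.
  suffices S1 : ∀ t : ℝ, ∫ x, g x • (t⁻¹ • (f (x + t • v) - f x)) ∂μ =
      ∫ x, (t⁻¹ • (g (x + t • (-v)) - g x)) • f x ∂μ by
    simp only [S1] at A; exact tendsto_nhds_unique A B
  intro t
  suffices S2 : ∫ x, g x • (f (x + t • v) - f x) ∂μ =
      ∫ x, (g (x + t • (-v)) - g x) • f x ∂μ by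
    simp_rw [smul_assoc, smul_comm (g _) t⁻¹, integral_smul, S2]
  have S3 : ∫ x, g x • f (x + t • v) ∂μ = ∫ x, g (x + t • (-v)) • f x ∂μ := by
    rw [← integral_add_right_eq_self _ (t • (-v))]; simp
  simp_rw [sub_smul, smul_sub]
  rw [integral_sub, integral_sub, S3]
  · exact Continuous.integrable_of_hasCompactSupport (by fun_prop)
      (h'g.comp_homeomorph (Homeomorph.addRight (t • (-v)))).smul_right
  · exact Continuous.integrable_of_hasCompactSupport (by fun_prop) h'g.smul_right
  · exact Continuous.integrable_of_hasCompactSupport (by fun_prop) h'g.smul_right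
  · exact Continuous.integrable_of_hasCompactSupport (by fun_prop) h'g.smul_right

theorem locallyIntegrable_lineDeriv (hf : LipschitzWith K f) (v : E) :
    LocallyIntegrable (fun x ↦ lineDeriv ℝ f x v) μ := by
  have := FiniteDimensional.proper ℝ E
  exact (memLp_top_of_bound (aestronglyMeasurable_lineDeriv hf.continuous μ)
    (K * ‖v‖) (.of_forall fun _ ↦ norm_lineDeriv_le_of_lipschitz ℝ hf)).locallyIntegrable le_top

/-- Line derivatives of a Lipschitz function are almost everywhere additive in the direction. -/
theorem ae_lineDeriv_add (hY : HasRadonNikodymProperty.{w, v} Y) (hf : LipschitzWith K f)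
    (u v : E) :
    ∀ᵐ x ∂μ, lineDeriv ℝ f x (u + v) = lineDeriv ℝ f x u + lineDeriv ℝ f x v := by
  have hfc := hf.continuous
  refine ae_eq_of_integral_contDiff_smul_eq (locallyIntegrable_lineDeriv hf _)
    ((locallyIntegrable_lineDeriv hf _).add (locallyIntegrable_lineDeriv hf _))
    fun g g_smooth g_comp ↦ ?_
  obtain ⟨D, g_lip⟩ : ∃ D, LipschitzWith D g :=
    ContDiff.lipschitzWith_of_hasCompactSupport g_comp g_smooth (by simp)
  have hint (v : E) : Integrable (fun x ↦ g x • lineDeriv ℝ f x v) μ :=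
    (locallyIntegrable_lineDeriv hf v).integrable_smul_left_of_hasCompactSupport
      g_smooth.continuous g_comp
  have hint' (v : E) : Integrable (fun x ↦ fderiv ℝ g x v • f x) μ := by
    refine Continuous.integrable_of_hasCompactSupport ?_ ?_
    · exact ((g_smooth.continuous_fderiv (by simp)).clm_apply continuous_const).smul hfc
    · exact ((g_comp.fderiv ℝ).comp_left (g := fun L : E →L[ℝ] ℝ ↦ L v) rfl).smul_right
  simp_rw [smul_add]
  rw [integral_add (hint u) (hint v)]
  -- The derivative now falls on the smooth `g`, where it is linear in the direction.
  simp_rw [hY.integral_smul_lineDeriv_eq hf g_lip g_comp,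
    (g_smooth.differentiable (by simp)).differentiableAt.lineDeriv_eq_fderiv]
  rw [← integral_add (hint' _) (hint' _)]
  simp_rw [← add_smul, ← map_add, neg_add]

end HasRadonNikodymProperty

end FiniteDimensional

/-! ### Reduction to countably many pairs of directions. -/

section LineDerivatives

variable {X : Type*} [NormedAddCommGroup X] [NormedSpace ℝ X]
  {Y : Type*} [NormedAddCommGroup Y] [NormedSpace ℝ Y] {f : X → Y} {K : ℝ≥0} {x : X}

theorem LipschitzWith.dist_slope_le (hf : LipschitzWith K f) (x v w : X) (t : ℝ) :
    dist (t⁻¹ • (f (x + t • v) - f x)) (t⁻¹ • (f (x + t • w) - f x)) ≤ K * dist v w := by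
  rcases eq_or_ne t 0 with rfl | ht
  · simp only [inv_zero, zero_smul, dist_self]
    positivity
  rw [dist_smul₀, dist_sub_right]
  calc ‖t⁻¹‖ * dist (f (x + t • v)) (f (x + t • w))
      ≤ ‖t⁻¹‖ * (K * dist (x + t • v) (x + t • w)) := by
        gcongr; exact hf.dist_le_mul _ _
    _ = K * dist v w := by
      rw [dist_add_left, dist_smul₀, norm_inv]
      field_simp [norm_ne_zero_iff.2 ht]

theorem LipschitzWith.lineDifferentiableAt_of_dense [CompleteSpace Y] (hf : LipschitzWith K f)
    {s : Set X} (hs : Dense s) (h : ∀ v ∈ s, LineDifferentiableAt ℝ f x v) (v : X) :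
    LineDifferentiableAt ℝ f x v := by
  have hcauchy : Cauchy (map (fun t : ℝ ↦ t⁻¹ • (f (x + t • v) - f x)) (𝓝[≠] 0)) := by
    refine Metric.cauchy_iff.2 ⟨inferInstance, fun ε hε ↦ ?_⟩
    -- Dividing by `K + 1` avoids a separate case for `K = 0`.
    obtain ⟨w, hws, hw⟩ := hs.exists_dist_lt v (show 0 < ε / 4 / (K + 1) by positivity)
    rw [lt_div_iff₀ (by positivity)] at hw
    have hw' : K * dist v w < ε / 4 := by nlinarith [dist_nonneg (x := v) (y := w)]
    refine ⟨Metric.ball (lineDeriv ℝ f x w) (ε / 2), ?_, fun a ha b hb ↦ ?_⟩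
    · rw [mem_map]
      filter_upwards [(h w hws).hasLineDerivAt.tendsto_slope_zero.eventually
        (Metric.ball_mem_nhds _ (show 0 < ε / 4 by positivity))] with t ht
      have := dist_triangle (t⁻¹ • (f (x + t • v) - f x)) (t⁻¹ • (f (x + t • w) - f x))
        (lineDeriv ℝ f x w)
      have := hf.dist_slope_le x v w t
      have ht' : dist (t⁻¹ • (f (x + t • w) - f x)) (lineDeriv ℝ f x w) < ε / 4 := ht
      rw [mem_preimage, Metric.mem_ball]
      linarith
    · have := dist_triangle_right a b (lineDeriv ℝ f x w)
      rw [Metric.mem_ball] at ha hb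
      linarith
  obtain ⟨y, hy⟩ := CompleteSpace.complete hcauchy
  exact (hasLineDerivAt_iff_tendsto_slope_zero.2 hy).lineDifferentiableAt

theorem LipschitzWith.lipschitzWith_lineDeriv (hf : LipschitzWith K f)
    (h : ∀ v, LineDifferentiableAt ℝ f x v) : LipschitzWith K (lineDeriv ℝ f x) :=
  LipschitzWith.of_dist_le_mul fun v w ↦
    le_of_tendsto ((h v).hasLineDerivAt.tendsto_slope_zero.dist
      (h w).hasLineDerivAt.tendsto_slope_zero) (.of_forall fun t ↦ hf.dist_slope_le x v w t)

/-- The line derivatives of `f` at `x` in the directions `u` and `u + v` exist, and the line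
derivative is additive at the pair `(u, v)`. -/
def HasAdditiveLineDerivAt (f : X → Y) (x u v : X) : Prop :=
  LineDifferentiableAt ℝ f x u ∧ LineDifferentiableAt ℝ f x (u + v) ∧
    lineDeriv ℝ f x (u + v) = lineDeriv ℝ f x u + lineDeriv ℝ f x v

theorem LineDifferentiableAt.hasAdditiveLineDerivAt_self {u : X}
    (h : LineDifferentiableAt ℝ f x u) : HasAdditiveLineDerivAt f x u u := by
  have h2 := h.hasLineDerivAt.smul 2
  rw [two_smul, two_smul] at h2
  exact ⟨h, h2.lineDifferentiableAt, h2.lineDeriv⟩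

/-- Existence and additivity of line derivatives pass from the dense range to all directions by the
Lipschitz bound, and a continuous additive map is real linear. -/
theorem LipschitzWith.gateauxDifferentiableAt_iff [CompleteSpace Y] (hf : LipschitzWith K f)
    {q : ℕ → X} (hq : DenseRange q) :
    GateauxDifferentiableAt f x ↔ ∀ i j, HasAdditiveLineDerivAt f x (q i) (q j) := by
  constructor
  · rintro ⟨T, hT⟩ i j
    exact ⟨(hT _).lineDifferentiableAt, (hT _).lineDifferentiableAt, by
      rw [(hT _).lineDeriv, (hT _).lineDeriv, (hT _).lineDeriv, map_add]⟩
  · intro h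
    have hd : ∀ v, LineDifferentiableAt ℝ f x v :=
      hf.lineDifferentiableAt_of_dense hq (by rintro _ ⟨i, rfl⟩; exact (h i i).1)
    have hc : Continuous (lineDeriv ℝ f x) := (hf.lipschitzWith_lineDeriv hd).continuous
    have hadd (u v : X) : lineDeriv ℝ f x (u + v) = lineDeriv ℝ f x u + lineDeriv ℝ f x v :=
      hq.induction_on₂ (isClosed_eq (by fun_prop) (by fun_prop)) (fun i j ↦ (h i j).2.2) u v
    exact ⟨(AddMonoidHom.mk' _ hadd).toRealLinearMap hc, fun v ↦ (hd v).hasLineDerivAt⟩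

theorem measurableSet_hasAdditiveLineDerivAt [CompleteSpace Y] [SecondCountableTopology X]
    [MeasurableSpace X] [BorelSpace X] (hf : Continuous f) (u v : X) :
    MeasurableSet {x | HasAdditiveLineDerivAt f x u v} :=
  (measurableSet_lineDifferentiableAt hf).inter <|
    (measurableSet_lineDifferentiableAt hf).inter <|
      (stronglyMeasurable_lineDeriv hf).measurableSet_eq_fun
        ((stronglyMeasurable_lineDeriv hf).add (stronglyMeasurable_lineDeriv hf))

theorem hasAdditiveLineDerivAt_comp_affine_iff {E : Type*} [NormedAddCommGroup E]
    [NormedSpace ℝ E] (L : E →L[ℝ] X) (y : X) (p u v : E) :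
    HasAdditiveLineDerivAt (fun p ↦ f (y + L p)) p u v ↔
      HasAdditiveLineDerivAt f (y + L p) (L u) (L v) := by
  simp only [HasAdditiveLineDerivAt, LineDifferentiableAt, lineDeriv, map_add, map_smul,
    add_assoc]

/-- A Lipschitz map into a space with the Radon–Nikodym property has additive line derivatives
almost everywhere on each finite-dimensional affine subspace. -/
theorem HasRadonNikodymProperty.ae_hasAdditiveLineDerivAt {Y : Type v} [NormedAddCommGroup Y]
    [NormedSpace ℝ Y] [CompleteSpace Y] {f : X → Y} (hY : HasRadonNikodymProperty.{w, v} Y)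
    (hf : LipschitzWith K f) {E : Type*} [NormedAddCommGroup E] [NormedSpace ℝ E]
    [MeasurableSpace E] [BorelSpace E] [FiniteDimensional ℝ E] (μ : Measure E)
    [μ.IsAddHaarMeasure] (L : E →L[ℝ] X) (y : X) (u v : E) :
    ∀ᵐ p ∂μ, HasAdditiveLineDerivAt f (y + L p) (L u) (L v) := by
  have hF := hf.comp ((LipschitzWith.const y).add L.lipschitz)
  filter_upwards [hY.ae_lineDifferentiableAt hF u, hY.ae_lineDifferentiableAt hF (u + v),
    hY.ae_lineDeriv_add hF u v] with p h1 h2 h3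
  exact (hasAdditiveLineDerivAt_comp_affine_iff L y p u v).1 ⟨h1, h2, h3⟩

end LineDerivatives

/-! ### Resampling coordinates of a product measure. -/

section Resampling

variable {ι : Type*} [DecidableEq ι] {Ω : ι → Type*} [∀ i, MeasurableSpace (Ω i)]
  (P : ∀ i, Measure (Ω i)) [∀ i, IsProbabilityMeasure (P i)]

/-- Resampling one coordinate independently preserves a product measure. -/
theorem measurePreserving_update_infinitePi (i : ι) :
    MeasurePreserving (fun p : (∀ k, Ω k) × Ω i ↦ Function.update p.1 i p.2)
      ((Measure.infinitePi P).prod (P i)) (Measure.infinitePi P) := by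
  have hm : Measurable (fun p : (∀ k, Ω k) × Ω i ↦ Function.update p.1 i p.2) :=
    measurable_update'
  refine ⟨hm, Measure.eq_infinitePi P fun s t ht ↦ ?_⟩
  rw [Measure.map_apply hm (.pi s.countable_toSet fun k _ ↦ ht k)]
  by_cases hi : i ∈ s
  · have : (fun p : (∀ k, Ω k) × Ω i ↦ Function.update p.1 i p.2) ⁻¹' (s : Set ι).pi t =
        ((s.erase i : Finset ι) : Set ι).pi t ×ˢ t i := by
      ext ⟨ω, a⟩
      simp only [mem_preimage, Set.mem_pi, mem_prod, Finset.mem_coe, Finset.mem_erase]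
      constructor
      · intro h
        refine ⟨fun k hk ↦ ?_, ?_⟩
        · simpa [hk.1] using h k hk.2
        · simpa using h i hi
      · rintro ⟨h1, h2⟩ k hk
        rcases eq_or_ne k i with rfl | hki
        · simpa using h2
        · simpa [hki] using h1 k ⟨hki, hk⟩
    rw [this, Measure.prod_prod, Measure.infinitePi_pi P (fun k _ ↦ ht k),
      Finset.prod_erase_mul _ _ hi]
  · have : (fun p : (∀ k, Ω k) × Ω i ↦ Function.update p.1 i p.2) ⁻¹' (s : Set ι).pi t =
        (s : Set ι).pi t ×ˢ univ := by
      ext ⟨ω, a⟩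
      simp only [mem_preimage, Set.mem_pi, mem_prod, Finset.mem_coe, mem_univ, and_true]
      refine forall₂_congr fun k hk ↦ ?_
      rw [Function.update_of_ne (ne_of_mem_of_not_mem hk hi)]
    rw [this, Measure.prod_prod, Measure.infinitePi_pi P (fun k _ ↦ ht k), measure_univ, mul_one]

/-- Resampling two coordinates preserves the product measure, so Fubini allows the rest of `ω` to be
frozen. -/
theorem ae_infinitePi_of_forall_ae_update (i j : ι) {s : Set (∀ k, Ω k)} (hs : MeasurableSet s)
    (h : ∀ ω, ∀ᵐ p ∂(P i).prod (P j), Function.update (Function.update ω i p.1) j p.2 ∈ s) :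
    ∀ᵐ ω ∂Measure.infinitePi P, ω ∈ s := by
  have hU := ((measurePreserving_update_infinitePi P j).comp
    ((measurePreserving_update_infinitePi P i).prod (MeasurePreserving.id (P j)))).comp
    (measurePreserving_prodAssoc (Measure.infinitePi P) (P i) (P j)).symm
  rw [← hU.map_eq]
  refine (ae_map_iff hU.measurable.aemeasurable hs).2 ?_
  exact (Measure.ae_prod_mem_iff_ae_ae_mem (hU.measurable hs)).2 (.of_forall h)

end Resampling

/-! ### The random series and its law. -/

section RandomSeries

open unitInterval

variable {X : Type*} [NormedAddCommGroup X] [NormedSpace ℝ X] {e : ℕ → X}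

theorem exists_pos_summable_norm_smul (q : ℕ → X) :
    ∃ c : ℕ → ℝ, (∀ k, 0 < c k) ∧ Summable fun k ↦ ‖c k • q k‖ := by
  refine ⟨fun k ↦ (1 / 2) ^ k * (1 + ‖q k‖)⁻¹, fun k ↦ by positivity,
    .of_nonneg_of_le (fun _ ↦ norm_nonneg _) (fun k ↦ ?_) summable_geometric_two⟩
  rw [norm_smul, Real.norm_of_nonneg (by positivity), mul_assoc]
  refine mul_le_of_le_one_right (by positivity) ?_
  rw [inv_mul_le_one₀ (by positivity)]
  linarith

theorem norm_unitInterval_smul_le (a : I) (x : X) : ‖(a : ℝ) • x‖ ≤ ‖x‖ := by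
  rw [norm_smul, Real.norm_of_nonneg a.2.1]
  exact mul_le_of_le_one_left (norm_nonneg x) a.2.2

/-- The series `∑ ωₖ eₖ` with coefficients in the unit interval. -/
noncomputable def unitIntervalSeries (e : ℕ → X) (ω : ℕ → I) : X := ∑' k, (ω k : ℝ) • e k

variable [CompleteSpace X]

theorem continuous_unitIntervalSeries (he : Summable (fun k ↦ ‖e k‖)) :
    Continuous (unitIntervalSeries e) :=
  continuous_tsum (fun k ↦ by fun_prop) he fun k ω ↦ norm_unitInterval_smul_le (ω k) (e k)

theorem unitIntervalSeries_update (he : Summable (fun k ↦ ‖e k‖)) (ω : ℕ → I) (i : ℕ) (a : I) :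
    unitIntervalSeries e (Function.update ω i a) =
      unitIntervalSeries e ω + ((a : ℝ) - ω i) • e i := by
  have hs : Summable fun k ↦ (ω k : ℝ) • e k :=
    .of_norm_bounded he fun k ↦ norm_unitInterval_smul_le (ω k) (e k)
  have h := (hs.hasSum.update i ((a : ℝ) • e i)).tsum_eq
  rw [unitIntervalSeries, unitIntervalSeries, sub_smul, add_comm, ← h]
  congr 1 with k
  rcases eq_or_ne k i with rfl | hk
  · simp
  · simp [hk]

/-- If almost every point of each affine plane parallel to `e i` and `e j` is in `s`, then every
translate of minus the random series `∑ ωₖ eₖ` is almost surely in `s`. -/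
theorem ae_sub_unitIntervalSeries_mem [MeasurableSpace X] [BorelSpace X]
    (he : Summable (fun k ↦ ‖e k‖)) {i j : ℕ} (hij : i ≠ j) {s : Set X} (hs : MeasurableSet s)
    (h : ∀ y, ∀ᵐ p : ℝ × ℝ, y - (p.1 • e i + p.2 • e j) ∈ s) (x : X) :
    ∀ᵐ ω ∂Measure.infinitePi fun _ : ℕ ↦ (volume : Measure I),
      x - unitIntervalSeries e ω ∈ s := by
  have hm : Measurable fun ω ↦ x - unitIntervalSeries e ω :=
    ((continuous_const.sub (continuous_unitIntervalSeries he))).measurable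
  refine ae_infinitePi_of_forall_ae_update _ i j
    (s := (fun ω ↦ x - unitIntervalSeries e ω) ⁻¹' s) (hm hs) fun ω ↦ ?_
  have hcoe := unitInterval.measurePreserving_coe.prod unitInterval.measurePreserving_coe
  rw [Measure.prod_restrict] at hcoe
  -- This base point cancels the contribution of the old coordinates `ω i` and `ω j`.
  have := hcoe.quasiMeasurePreserving.ae (ae_restrict_of_ae
    (h (x - unitIntervalSeries e ω + ((ω i : ℝ) • e i + (ω j : ℝ) • e j))))
  filter_upwards [this] with p hp
  rw [mem_preimage, unitIntervalSeries_update he, unitIntervalSeries_update he,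
    Function.update_of_ne hij.symm]
  convert hp using 1
  simp only [Prod.map_fst, Prod.map_snd, sub_smul]
  abel

end RandomSeries

/-! ### Conclusion. -/

theorem IsChristensenZeroSet.ne_univ {X : Type*} [NormedAddCommGroup X] [MeasurableSpace X]
    [BorelSpace X] {A : Set X} (hA : IsChristensenZeroSet A) : A ≠ univ := by
  rintro rfl
  obtain ⟨-, μ, hμ, h⟩ := hA
  simpa using h 0

theorem theorem1p2 {X : Type u} [NormedAddCommGroup X] [NormedSpace ℝ X]
    [CompleteSpace X] [TopologicalSpace.SeparableSpace X] [MeasurableSpace X] [BorelSpace X]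
    {Y : Type v} [NormedAddCommGroup Y] [NormedSpace ℝ Y] [CompleteSpace Y]
    (hY : HasRadonNikodymProperty.{w, v} Y) (f : X → Y) (K : ℝ≥0) (hf : LipschitzWith K f) :
    (∃ x : X, GateauxDifferentiableAt f x) ∧
      IsChristensenZeroSet {x : X | ¬ GateauxDifferentiableAt f x} := by
  suffices h : IsChristensenZeroSet {x : X | ¬ GateauxDifferentiableAt f x} by
    refine ⟨?_, h⟩
    by_contra! hne
    exact h.ne_univ (eq_univ_of_forall hne)
  have : SecondCountableTopology X := UniformSpace.secondCountable_of_separable X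
  obtain ⟨q, hq⟩ := TopologicalSpace.exists_dense_seq X
  have hmeas : MeasurableSet {x : X | ¬ GateauxDifferentiableAt f x} := by
    have heq : {x : X | GateauxDifferentiableAt f x} =
        ⋂ i, ⋂ j, {x | HasAdditiveLineDerivAt f x (q i) (q j)} := by
      ext x
      simpa using hf.gateauxDifferentiableAt_iff hq
    refine MeasurableSet.compl (s := {x : X | GateauxDifferentiableAt f x}) ?_
    rw [heq]
    exact .iInter fun i ↦ .iInter fun j ↦
      measurableSet_hasAdditiveLineDerivAt hf.continuous (q i) (q j)
  obtain ⟨c, hc, hsum⟩ := exists_pos_summable_norm_smul q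
  have hS : Measurable (unitIntervalSeries fun k ↦ c k • q k) :=
    (continuous_unitIntervalSeries hsum).measurable
  have key (x : X) (i j : ℕ) (hij : i ≠ j) :
      ∀ᵐ ω ∂Measure.infinitePi fun _ : ℕ ↦ (volume : Measure unitInterval),
        HasAdditiveLineDerivAt f (x - unitIntervalSeries (fun k ↦ c k • q k) ω) (q i) (q j) := by
    refine ae_sub_unitIntervalSeries_mem hsum hij
      (measurableSet_hasAdditiveLineDerivAt hf.continuous (q i) (q j)) (fun y ↦ ?_) x
    -- The sign matches the reflection in `x - y`; the preimages of `q i` and `q j` undo it together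
    -- with the weights.
    let L : ℝ × ℝ →L[ℝ] X := -((ContinuousLinearMap.fst ℝ ℝ ℝ).smulRight (c i • q i) +
      (ContinuousLinearMap.snd ℝ ℝ ℝ).smulRight (c j • q j))
    have hLi : L (-(c i)⁻¹, 0) = q i := by simp [L, smul_smul, (hc i).ne']
    have hLj : L (0, -(c j)⁻¹) = q j := by simp [L, smul_smul, (hc j).ne']
    have h := hY.ae_hasAdditiveLineDerivAt hf volume L y (-(c i)⁻¹, 0) (0, -(c j)⁻¹)
    rw [hLi, hLj] at h
    filter_upwards [h] with p hp
    simpa [L, sub_eq_add_neg] using hp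
  refine ⟨hmeas, _, Measure.isProbabilityMeasure_map
    (μ := Measure.infinitePi fun _ : ℕ ↦ (volume : Measure unitInterval)) hS.aemeasurable,
    fun x ↦ ?_⟩
  have hmeas' : Measurable fun y : X ↦
      {x : X | ¬ GateauxDifferentiableAt f x}.indicator (fun _ ↦ (1 : ℝ≥0∞)) (x - y) :=
    (measurable_const.indicator hmeas).comp (measurable_const.sub measurable_id)
  rw [lintegral_map hmeas' hS]
  refine lintegral_eq_zero_of_ae_eq_zero ?_
  have hall : ∀ᵐ ω ∂Measure.infinitePi fun _ : ℕ ↦ (volume : Measure unitInterval),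
      ∀ i j : ℕ, i ≠ j →
        HasAdditiveLineDerivAt f (x - unitIntervalSeries (fun k ↦ c k • q k) ω) (q i) (q j) := by
    simp_rw [ae_all_iff]
    exact key x
  filter_upwards [hall] with ω hω
  refine indicator_of_notMem (not_not_intro ?_) _
  refine (hf.gateauxDifferentiableAt_iff hq).2 fun i j ↦ ?_
  rcases eq_or_ne i j with rfl | hij
  -- Resampling needs distinct coordinates, so the diagonal uses only differentiability along `q i`,
  -- read off from any other pair.
  · exact (hω i (i + 1) (by simp)).1.hasAdditiveLineDerivAt_self
  · exact hω i j hij
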